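/- A quasi-metric on a set $E$ is a function $d:E\times E\to[0,+\infty[$ such that, for all $x,y,z\in E$, $x=y$ if and only if $d(x,y)=d(y,x)=0$, and $d(x,z)\le d(x,y)+d(y,z)$. Its topology is the one generated by the open balls $\{y\in E : d(x,y)<r\}$ with $x\in E$ and $r>0$. A sequence $(x_n)_{n\in\mathbb N}$ in $E$ is Cauchy if $\lim_{n\to\infty}\sup_{p\ge n}d(x_n,x_p)=0$, and $d$ is complete if every Cauchy sequence converges with respect to the metric $\widehat d(x,y)=\max\{d(x,y),d(y,x)\}$. A topological space is quasi-Polish if it has a countable basis and its topology is the topology of some complete quasi-metric. A convergent approximation space is a topological space $E$ for which there are a topological basis $\mathcal B$ and a binary relation $\ll$ on $\mathcal B$ such that, for all $U,V,T\in\mathcal B$: (1) if $U\ll V$ then $V\subseteq U$; (2) if $U\subseteq T$ and $U\ll V$ then $T\ll V$; (3) for every $x\in U$ there is $W\in\mathcal B$ with $x\in W$ and $U\ll W$; (4) for every sequence $(U_i)_{i\in\mathbb N}$ in $\mathcal B$ with $U_i\ll U_{i+1}$ for all $i$ there is a point $x\in\bigcap_{i\in\mathbb N}U_i$ such that every open set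 containing $x$ contains some $U_i$. Theorem. A topological space is quasi-Polish if and only if it is a $T_0$ convergent approximation space with a countable basis. -/

import Mathlib

open Filter Topology

/-- A quasi-metric on `E`: a metric without the symmetry axiom. -/
structure QuasiMetric (E : Type*) where
  /-- the quasi-distance -/
  d : E → E → ℝ
  nonneg : ∀ x y, 0 ≤ d x y
  eq_iff : ∀ x y, x = y ↔ d x y = 0 ∧ d y x = 0
  triangle : ∀ x y z, d x z ≤ d x y + d y z

namespace QuasiMetric

/-- The open ball `{y | d(x,y) < r}`; the centre is the first argument of `d`. -/
def ball {E : Type*} (q : QuasiMetric E) (x : E) (r : ℝ) : Set E := {y | q.d x y < r}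

/-- The topology generated by the open balls. -/
abbrev topology {E : Type*} (q : QuasiMetric E) : TopologicalSpace E :=
  TopologicalSpace.generateFrom {B | ∃ (x : E) (r : ℝ), 0 < r ∧ B = q.ball x r}

/-- A sequence is Cauchy if `sup_{p ≥ n} d(x_n, x_p)` tends to `0` as `n` tends to infinity. -/
def IsCauchy {E : Type*} (q : QuasiMetric E) (x : ℕ → E) : Prop :=
  ∀ ε : ℝ, 0 < ε → ∃ N : ℕ, ∀ n, N ≤ n → ∀ p, n ≤ p → q.d (x n) (x p) < ε

/-- The symmetrized metric `max (d(x,y)) (d(y,x))`. -/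
def hat {E : Type*} (q : QuasiMetric E) (x y : E) : ℝ := max (q.d x y) (q.d y x)

/-- Every Cauchy sequence converges with respect to the symmetrized metric. -/
def IsComplete {E : Type*} (q : QuasiMetric E) : Prop :=
  ∀ x : ℕ → E, q.IsCauchy x → ∃ a : E, Tendsto (fun n => q.hat (x n) a) atTop (𝓝 0)

end QuasiMetric

/-- A topological space is quasi-Polish if it has a countable basis and its topology is the
topology of some complete quasi-metric. -/
def IsQuasiPolish (E : Type*) [t : TopologicalSpace E] : Prop :=
  SecondCountableTopology E ∧ ∃ q : QuasiMetric E, q.IsComplete ∧ t = q.topology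

/-- `R` is a convergent approximation relation on the topological basis `B` of `E`. Only the
values of `R` at members of `B` are used. -/
structure IsConvergentApproximationRelation {E : Type*} [TopologicalSpace E]
    (B : Set (Set E)) (R : Set E → Set E → Prop) : Prop where
  isBasis : TopologicalSpace.IsTopologicalBasis B
  subset : ∀ U ∈ B, ∀ V ∈ B, R U V → V ⊆ U
  mono : ∀ U ∈ B, ∀ V ∈ B, ∀ T ∈ B, U ⊆ T → R U V → R T V
  exists_mem : ∀ U ∈ B, ∀ x ∈ U, ∃ W ∈ B, x ∈ W ∧ R U W
  converges : ∀ U : ℕ → Set E, (∀ i, U i ∈ B) → (∀ i, R (U i) (U (i + 1))) →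
    ∃ x ∈ ⋂ i, U i, ∀ O : Set E, IsOpen O → x ∈ O → ∃ i, U i ⊆ O

/-- A convergent approximation space: some topological basis carries a convergent approximation
relation. -/
def IsConvergentApproximationSpace (E : Type*) [TopologicalSpace E] : Prop :=
  ∃ (B : Set (Set E)) (R : Set E → Set E → Prop), IsConvergentApproximationRelation B R

/-!
Both directions go through countable data.

*From a quasi-metric to an approximation relation.* The formal balls `(s i, 1 / (j + 1))`, with `s`
dense for the symmetrized metric, form a countable system of open sets `O n` with a relation `prec`
such that points common to two members lie in a common `prec`-successor, and such that every
`prec`-chain shrinks to a point (`prec` halves radii, so completeness applies). The difficulty is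
that the relation `R` has to be memoryless and monotone, whereas the chain of formal balls is not
recoverable from a set. Each set `T` is therefore given a code: a greedily built `prec`-chain of
formal balls containing `T`, the `k`-th step also being required to go below `O k` if `T ⊆ O k`; the
code takes the value `⊤` from the place where the construction breaks down. Put `R U V` if `V ⊆ U`
and `V` does not share a terminated code with any superset of `U`. This is monotone by definition. A
suitable `V` exists around each point because codes have a sandwich property
(`CodeAgree.sandwich`). Along a decreasing sequence of sets every entry of the code stabilizes
(`exists_codeAgree_stable`), so an `R`-chain has an infinite limit code, and the point to which that
chain of formal balls shrinks is the required limit.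

*From an approximation relation to a quasi-metric.* The relation is first transported to a basis
`W : ℕ → Set E`. For the `n`-th of countably many constraints `A n` on indices (being below a given
`W o` and in relation to a given `W u`), let `leastIndex` be the first index `v` satisfying the
constraint and with `x ∈ W v`. The quasi-distance from `x` to `y` is `1 / (n + 1)` for the first `n`
at which this value increases. Along a Cauchy sequence each value stabilizes, so at each stage one
index serves all late terms, and an `R`-chain can be constructed whose limit is the limit of the
sequence.
-/

/-! ### Basic facts on quasi-metrics -/

namespace QuasiMetric

variable {E : Type*}

theorem d_self (q : QuasiMetric E) (x : E) : q.d x x = 0 := ((q.eq_iff x x).1 rfl).1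

theorem mem_ball_self (q : QuasiMetric E) (x : E) {r : ℝ} (hr : 0 < r) : x ∈ q.ball x r := by
  simpa [ball, d_self] using hr

theorem isOpen_iff [t : TopologicalSpace E] {q : QuasiMetric E} (ht : t = q.topology)
    (O : Set E) : IsOpen O ↔ ∀ x ∈ O, ∃ r : ℝ, 0 < r ∧ q.ball x r ⊆ O := by
  subst ht
  constructor
  · intro h
    induction h with
    | basic s hs =>
      obtain ⟨c, r, -, rfl⟩ := hs
      intro x hx
      have hx' : q.d c x < r := hx
      refine ⟨r - q.d c x, by linarith, fun y hy => ?_⟩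
      have hy' : q.d x y < r - q.d c x := hy
      have := q.triangle c x y
      change q.d c y < r
      linarith
    | univ => exact fun x _ => ⟨1, one_pos, Set.subset_univ _⟩
    | inter s t _ _ ihs iht =>
      rintro x ⟨hs, ht⟩
      obtain ⟨r, hr, h⟩ := ihs x hs
      obtain ⟨r', hr', h'⟩ := iht x ht
      refine ⟨min r r', lt_min hr hr', fun y hy => ⟨h ?_, h' ?_⟩⟩
      · exact lt_of_lt_of_le (show q.d x y < min r r' from hy) (min_le_left _ _)
      · exact lt_of_lt_of_le (show q.d x y < min r r' from hy) (min_le_right _ _)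
    | sUnion S _ ih =>
      rintro x ⟨s, hs, hx⟩
      obtain ⟨r, hr, h⟩ := ih s hs x hx
      exact ⟨r, hr, h.trans (Set.subset_sUnion_of_mem hs)⟩
  · intro h
    choose! r hr hO using h
    have : O = ⋃ x ∈ O, q.ball x (r x) := by
      apply Set.Subset.antisymm
      · exact fun x hx => Set.mem_biUnion hx (q.mem_ball_self x (hr x hx))
      · exact Set.iUnion₂_subset hO
    rw [this]
    let _ : TopologicalSpace E := q.topology
    exact isOpen_biUnion fun x hx =>
      TopologicalSpace.isOpen_generateFrom_of_mem ⟨x, r x, hr x hx, rfl⟩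

theorem isOpen_ball [t : TopologicalSpace E] {q : QuasiMetric E} (ht : t = q.topology)
    (x : E) {r : ℝ} (hr : 0 < r) : IsOpen (q.ball x r) := by
  subst ht
  exact TopologicalSpace.isOpen_generateFrom_of_mem ⟨x, r, hr, rfl⟩

theorem t0Space [t : TopologicalSpace E] {q : QuasiMetric E} (ht : t = q.topology) :
    T0Space E := by
  refine ⟨fun x y h => ?_⟩
  have key : ∀ a b : E, Inseparable a b → q.d a b = 0 := by
    intro a b hab
    refine le_antisymm (le_of_forall_pos_lt_add fun ε hε => ?_) (q.nonneg a b)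
    rw [zero_add]
    exact (hab.mem_open_iff (isOpen_ball ht a hε)).1 (q.mem_ball_self a hε)
  exact (q.eq_iff x y).2 ⟨key x y h, key y x h.symm⟩

end QuasiMetric

theorem exists_seq_isTopologicalBasis (E : Type*) [TopologicalSpace E]
    [SecondCountableTopology E] :
    ∃ W : ℕ → Set E, TopologicalSpace.IsTopologicalBasis (Set.range W) := by
  obtain ⟨b, hc, -, hb⟩ := TopologicalSpace.exists_countable_basis E
  obtain ⟨W, hW⟩ := (hc.insert Set.univ).exists_eq_range (Set.insert_nonempty _ _)
  refine ⟨W, hW ▸ TopologicalSpace.isTopologicalBasis_of_isOpen_of_nhds ?_ ?_⟩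
  · rintro u (rfl | hu)
    · exact isOpen_univ
    · exact hb.isOpen hu
  · intro a u ha hu
    obtain ⟨v, hv, hav, hvu⟩ := hb.exists_subset_of_mem_open ha hu
    exact ⟨v, Or.inr hv, hav, hvu⟩

/-! ### Codes of sets -/

section Code

variable {E : Type*}

open Classical in
/-- The code of `T`, relative to sets `O n` and a relation `prec` on their indices: each entry is
the least index `n` with `T ⊆ O n` that is a successor of the preceding entry and, in entry `k + 1`,
also a successor of `k` if `T ⊆ O k`. An entry is `⊤` if there is no such `n`, and then so are all
the later ones. -/
noncomputable def setCode (O : ℕ → Set E) (prec : ℕ → ℕ → Prop) (T : Set E) : ℕ → ℕ∞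
  | 0 => sInf ((fun n : ℕ => (n : ℕ∞)) '' {n | T ⊆ O n})
  | k + 1 => sInf ((fun n : ℕ => (n : ℕ∞)) ''
      {n | T ⊆ O n ∧ (∃ m : ℕ, setCode O prec T k = m ∧ prec m n) ∧ (T ⊆ O k → prec k n)})

theorem ENat.sInf_coe_eq_top {S : Set ℕ} :
    sInf ((fun n : ℕ => (n : ℕ∞)) '' S) = ⊤ ↔ S = ∅ := by
  constructor
  · intro h
    by_contra hS
    obtain ⟨n, hn⟩ := Set.nonempty_iff_ne_empty.2 hS
    exact ENat.natCast_ne_top n (sInf_eq_top.1 h _ ⟨n, hn, rfl⟩)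
  · rintro rfl
    simp

theorem ENat.mem_of_sInf_coe_eq {S : Set ℕ} {m : ℕ}
    (h : sInf ((fun n : ℕ => (n : ℕ∞)) '' S) = m) : m ∈ S := by
  have hS : S.Nonempty := by
    rw [Set.nonempty_iff_ne_empty]
    intro hS
    rw [ENat.sInf_coe_eq_top.2 hS] at h
    exact ENat.natCast_ne_top m h.symm
  obtain ⟨n, hn, hnm⟩ := csInf_mem (hS.image (fun n : ℕ => (n : ℕ∞)))
  rw [h] at hnm
  have : n = m := Nat.cast_injective hnm
  exact this ▸ hn

/-- `A` and `B` have the same code up to entry `k`, and are contained in the same `O j`, `j < k`. -/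
def CodeAgree (O : ℕ → Set E) (prec : ℕ → ℕ → Prop) (k : ℕ) (A B : Set E) : Prop :=
  (∀ j < k, (A ⊆ O j ↔ B ⊆ O j)) ∧ ∀ j ≤ k, setCode O prec A j = setCode O prec B j

variable {O : ℕ → Set E} {prec : ℕ → ℕ → Prop}

theorem setCode_zero_anti {U T : Set E} (h : U ⊆ T) :
    setCode O prec U 0 ≤ setCode O prec T 0 :=
  sInf_le_sInf (Set.image_mono fun _ hn => h.trans hn)

theorem setCode_succ_anti {U T : Set E} {k : ℕ} (h : U ⊆ T)
    (hk : setCode O prec U k = setCode O prec T k) (hO : U ⊆ O k ↔ T ⊆ O k) :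
    setCode O prec U (k + 1) ≤ setCode O prec T (k + 1) := by
  apply sInf_le_sInf
  apply Set.image_mono
  rintro n ⟨h1, ⟨m, hm, hmn⟩, h3⟩
  exact ⟨h.trans h1, ⟨m, hk.trans hm, hmn⟩, fun hU => h3 (hO.1 hU)⟩

theorem CodeAgree.sandwich {V U T : Set E} (hVU : V ⊆ U) (hUT : U ⊆ T) {k : ℕ}
    (h : CodeAgree O prec k V T) : CodeAgree O prec k V U := by
  have hO : ∀ j < k, (V ⊆ O j ↔ U ⊆ O j) := fun j hj =>
    ⟨fun hV => hUT.trans ((h.1 j hj).1 hV), hVU.trans⟩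
  refine ⟨hO, fun j => ?_⟩
  induction j with
  | zero =>
    intro h0
    exact le_antisymm (setCode_zero_anti hVU) ((setCode_zero_anti hUT).trans (h.2 0 h0).ge)
  | succ j ih =>
    intro hj
    have e := ih (by omega)
    refine le_antisymm (setCode_succ_anti hVU e (hO j hj)) ?_
    refine (setCode_succ_anti hUT ?_ ?_).trans (h.2 _ hj).ge
    · rw [← e, h.2 j (by omega)]
    · rw [← hO j hj, h.1 j hj]

theorem setCode_zero_mem {T : Set E} {m : ℕ} (h : setCode O prec T 0 = m) : T ⊆ O m :=
  ENat.mem_of_sInf_coe_eq (S := {n | T ⊆ O n}) (by rw [← h, setCode])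

theorem setCode_succ_mem {T : Set E} {k m : ℕ} (h : setCode O prec T (k + 1) = m) :
    T ⊆ O m ∧ (∃ l : ℕ, setCode O prec T k = l ∧ prec l m) ∧ (T ⊆ O k → prec k m) :=
  ENat.mem_of_sInf_coe_eq (S := {n | T ⊆ O n ∧
    (∃ m : ℕ, setCode O prec T k = m ∧ prec m n) ∧ (T ⊆ O k → prec k n)}) (by rw [← h, setCode])

theorem setCode_mem {T : Set E} {k m : ℕ} (h : setCode O prec T k = m) : T ⊆ O m := by
  cases k with
  | zero => exact setCode_zero_mem h
  | succ k => exact (setCode_succ_mem h).1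

theorem setCode_zero_ne_top {T : Set E} {m : ℕ} (h : T ⊆ O m) : setCode O prec T 0 ≠ ⊤ := by
  rw [setCode, Ne, ENat.sInf_coe_eq_top, ← Ne, ← Set.nonempty_iff_ne_empty]
  exact ⟨m, h⟩

theorem setCode_succ_ne_top {T : Set E} {k l m : ℕ} (h : T ⊆ O m)
    (hl : setCode O prec T k = l) (hlm : prec l m) (hk : T ⊆ O k → prec k m) :
    setCode O prec T (k + 1) ≠ ⊤ := by
  rw [setCode, Ne, ENat.sInf_coe_eq_top, ← Ne, ← Set.nonempty_iff_ne_empty]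
  exact ⟨m, h, ⟨l, hl, hlm⟩, hk⟩

theorem exists_forall_ge_eq_of_antitone {u : ℕ → ℕ∞} {N : ℕ}
    (h : ∀ i, N ≤ i → ∀ p, i ≤ p → u p ≤ u i) : ∃ M, N ≤ M ∧ ∀ i, M ≤ i → u i = u M := by
  obtain ⟨L, ⟨M, hM, rfl⟩, hmin⟩ :=
    wellFounded_lt.has_min (u '' Set.Ici N) (Set.nonempty_Ici.image u)
  refine ⟨M, hM, fun i hi => le_antisymm (h M hM i hi) ?_⟩
  exact not_lt.1 (hmin _ ⟨i, le_trans hM hi, rfl⟩)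

/-- Along a decreasing sequence of sets, the code stabilizes entry by entry. -/
theorem exists_codeAgree_stable {U : ℕ → Set E} (hU : Antitone U) (k : ℕ) :
    ∃ N, ∀ i, N ≤ i → CodeAgree O prec k (U i) (U N) := by
  induction k with
  | zero =>
    obtain ⟨M, -, hM⟩ := exists_forall_ge_eq_of_antitone (N := 0)
      (u := fun i => setCode O prec (U i) 0) fun i _ p hp => setCode_zero_anti (hU hp)
    refine ⟨M, fun i hi => ⟨by simp, fun j hj => ?_⟩⟩
    obtain rfl : j = 0 := by omega
    exact hM i hi
  | succ k ih =>
    obtain ⟨N₀, hN₀⟩ := ih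
    obtain ⟨N, hN, hO⟩ : ∃ N, N₀ ≤ N ∧ ∀ i, N ≤ i → (U i ⊆ O k ↔ U N ⊆ O k) := by
      by_cases h : ∃ i, N₀ ≤ i ∧ U i ⊆ O k
      · obtain ⟨N, hN, hUN⟩ := h
        exact ⟨N, hN, fun i hi => iff_of_true ((hU hi).trans hUN) hUN⟩
      · push Not at h
        exact ⟨N₀, le_rfl, fun i hi => iff_of_false (h i hi) (h N₀ le_rfl)⟩
    obtain ⟨M, hNM, hM⟩ := exists_forall_ge_eq_of_antitone (N := N)
      (u := fun i => setCode O prec (U i) (k + 1)) fun i hi p hp => by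
        apply setCode_succ_anti (hU hp)
        · rw [(hN₀ i (by omega)).2 k le_rfl, (hN₀ p (by omega)).2 k le_rfl]
        · rw [hO i hi, hO p (by omega)]
    refine ⟨M, fun i hi => ⟨fun j hj => ?_, fun j hj => ?_⟩⟩
    · rcases Nat.lt_succ_iff_lt_or_eq.1 hj with hj | rfl
      · rw [(hN₀ i (by omega)).1 j hj, (hN₀ M (by omega)).1 j hj]
      · rw [hO i (by omega), hO M hNM]
    · rcases Nat.le_succ_iff.1 hj with hj | rfl
      · rw [(hN₀ i (by omega)).2 j hj, (hN₀ M (by omega)).2 j hj]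
      · exact hM i hi

/-- A countable basis with a relation on indices whose chains shrink to points yields a convergent
approximation relation: `V` is related to `U` if `V ⊆ U` and no superset of `U` has a terminated
code that agrees with the code of `V` up to where it terminates. -/
theorem isConvergentApproximationRelation_of_chains [TopologicalSpace E]
    (hbasis : TopologicalSpace.IsTopologicalBasis (Set.range O))
    (hsub : ∀ n m, prec n m → O m ⊆ O n)
    (hdir : ∀ n m x, x ∈ O n → x ∈ O m → ∃ c, prec n c ∧ prec m c ∧ x ∈ O c)
    (hchain : ∀ c : ℕ → ℕ, (∀ k, prec (c k) (c (k + 1))) →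
      ∃ x ∈ ⋂ k, O (c k), ∀ S : Set E, IsOpen S → x ∈ S → ∃ k, O (c k) ⊆ S) :
    IsConvergentApproximationRelation (Set.range O) fun U V => V ⊆ U ∧
      ∀ T, U ⊆ T → ∀ k, setCode O prec T k = ⊤ → ¬ CodeAgree O prec k V T where
  isBasis := hbasis
  subset _ _ _ _ h := h.1
  mono _ _ _ _ _ _ hUT h := ⟨h.1.trans hUT, fun T hT => h.2 T (hUT.trans hT)⟩
  exists_mem := by
    intro U hU x hx
    have hUo : IsOpen U := hbasis.isOpen hU
    -- It suffices to get out of the first place where the code of `U` itself terminates.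
    suffices h : ∃ V ∈ Set.range O, x ∈ V ∧ V ⊆ U ∧
        ∀ k, setCode O prec U k = ⊤ → ¬ CodeAgree O prec k V U by
      obtain ⟨V, hV, hxV, hVU, h⟩ := h
      refine ⟨V, hV, hxV, hVU, fun T hT k hk hag => h k ?_ (hag.sandwich hVU hT)⟩
      rw [← (hag.sandwich hVU hT).2 k le_rfl, hag.2 k le_rfl, hk]
    by_cases hfin : ∃ k, setCode O prec U k = ⊤
    swap
    · exact ⟨U, hU, hx, subset_rfl, fun k hk => (hfin ⟨k, hk⟩).elim⟩
    classical
    have hmin : ∀ k, setCode O prec U k = ⊤ → Nat.find hfin ≤ k := fun k hk => Nat.find_min' hfin hk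
    have hterm := Nat.find_spec hfin
    have hlow : ∀ j < Nat.find hfin, setCode O prec U j ≠ ⊤ := fun j hj => Nat.find_min hfin hj
    generalize Nat.find hfin = k₀ at hmin hterm hlow
    suffices h : ∃ V ∈ Set.range O, x ∈ V ∧ V ⊆ U ∧ ¬ CodeAgree O prec k₀ V U by
      obtain ⟨V, hV, hxV, hVU, h⟩ := h
      exact ⟨V, hV, hxV, hVU, fun k hk hag => h ⟨fun j hj => hag.1 j (hj.trans_le (hmin k hk)),
        fun j hj => hag.2 j (hj.trans (hmin k hk))⟩⟩
    obtain _ | k := k₀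
    · obtain ⟨n, rfl⟩ := hU
      exact (setCode_zero_ne_top subset_rfl hterm).elim
    obtain ⟨m, hm⟩ := ENat.ne_top_iff_exists.1 (hlow k (by omega))
    obtain ⟨c, hmc, hkc, hxc⟩ : ∃ c, prec m c ∧ (U ⊆ O k → prec k c) ∧ x ∈ O c := by
      have hxm := setCode_mem hm.symm hx
      by_cases hk : U ⊆ O k
      · obtain ⟨c, h1, h2, h3⟩ := hdir m k x hxm (hk hx)
        exact ⟨c, h1, fun _ => h2, h3⟩
      · obtain ⟨c, h1, -, h3⟩ := hdir m m x hxm hxm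
        exact ⟨c, h1, fun h => (hk h).elim, h3⟩
    obtain ⟨V, hV, hxV, hVs⟩ := hbasis.exists_subset_of_mem_open (⟨hx, hxc⟩ : x ∈ U ∩ O c)
      (hUo.inter (hbasis.isOpen ⟨c, rfl⟩))
    refine ⟨V, hV, hxV, hVs.trans Set.inter_subset_left, fun hag => ?_⟩
    refine setCode_succ_ne_top (hVs.trans Set.inter_subset_right) ?_ hmc ?_
      ((hag.2 (k + 1) le_rfl).trans hterm)
    · rw [hag.2 k (by omega), hm]
    · exact fun hVk => hkc ((hag.1 k (by omega)).1 hVk)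
  converges := by
    intro U hU hR
    have hanti : Antitone U := antitone_nat_of_succ_le fun i => (hR i).1
    choose N hN using fun k => exists_codeAgree_stable (O := O) (prec := prec) hanti k
    have hne : ∀ k, setCode O prec (U (N k)) k ≠ ⊤ := fun k hk =>
      (hR (N k)).2 _ subset_rfl k hk (hN k _ (by omega))
    choose c hc using fun k => ENat.ne_top_iff_exists.1 (hne k)
    have hcode : ∀ k i, N k ≤ i → setCode O prec (U i) k = c k := fun k i hi =>
      ((hN k i hi).2 k le_rfl).trans (hc k).symm
    have hUc : ∀ k i, N k ≤ i → U i ⊆ O (c k) := fun k i hi => setCode_mem (hcode k i hi)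
    obtain ⟨x, hx, hnhds⟩ := hchain c fun k => by
      obtain ⟨-, ⟨l, hl, hlm⟩, -⟩ :=
        setCode_succ_mem (hcode (k + 1) (max (N k) (N (k + 1))) (le_max_right _ _))
      rw [hcode k _ (le_max_left _ _)] at hl
      have : c k = l := by exact_mod_cast hl
      exact this ▸ hlm
    refine ⟨x, Set.mem_iInter.2 fun i => ?_, fun S hS hxS => ?_⟩
    · -- `U i = O p`, and entry `p + 1` of the limit code is a successor of `p`.
      obtain ⟨p, hp⟩ := hU i
      obtain ⟨-, -, h⟩ := setCode_succ_mem (hcode (p + 1) (max i (N (p + 1))) (le_max_right _ _))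
      rw [← hp]
      refine hsub _ _ (h ?_) (Set.mem_iInter.1 hx (p + 1))
      rw [hp]
      exact hanti (le_max_left _ _)
    · obtain ⟨k, hk⟩ := hnhds S hS hxS
      exact ⟨N k, (hUc k _ le_rfl).trans hk⟩

end Code

/-! ### From a complete quasi-metric to an approximation relation -/

namespace QuasiMetric

variable {E : Type*}

/-- A second countable quasi-metric space is separable for the symmetrized metric. -/
theorem exists_seq_dense_hat [t : TopologicalSpace E] [SecondCountableTopology E] [Nonempty E]
    {q : QuasiMetric E} (ht : t = q.topology) :
    ∃ s : ℕ → E, ∀ y, ∀ ε : ℝ, 0 < ε → ∃ n, q.d (s n) y < ε ∧ q.d y (s n) < ε := by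
  obtain ⟨W, hW⟩ := exists_seq_isTopologicalBasis E
  have : ∀ n m : ℕ, ∃ z : E, (∃ x, x ∈ W n ∧ W n ⊆ q.ball x (1 / ((m : ℝ) + 1))) →
      z ∈ W n ∧ W n ⊆ q.ball z (1 / ((m : ℝ) + 1)) := by
    intro n m
    by_cases h : ∃ x, x ∈ W n ∧ W n ⊆ q.ball x (1 / ((m : ℝ) + 1))
    · exact ⟨h.choose, fun _ => h.choose_spec⟩
    · exact ⟨Classical.arbitrary E, fun h' => (h h').elim⟩
  choose s hs using this
  refine ⟨fun n => s n.unpair.1 n.unpair.2, fun y ε hε => ?_⟩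
  obtain ⟨m, hm⟩ := exists_nat_one_div_lt hε
  have hpos : (0 : ℝ) < 1 / ((m : ℝ) + 1) := Nat.one_div_pos_of_nat
  obtain ⟨_, ⟨n, rfl⟩, hyn, hn⟩ :=
    hW.exists_subset_of_mem_open (q.mem_ball_self y hpos) (isOpen_ball ht y hpos)
  obtain ⟨h1, h2⟩ := hs n m ⟨y, hyn, hn⟩
  refine ⟨Nat.pair n m, ?_⟩
  simp only [Nat.unpair_pair]
  exact ⟨lt_trans (h2 hyn) hm, lt_trans (hn h1) hm⟩

/-- A chain of formal balls with radii at least halving at each step shrinks to a point. -/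
theorem IsComplete.exists_limit_of_chain [t : TopologicalSpace E] {q : QuasiMetric E}
    (ht : t = q.topology) (hq : q.IsComplete) (x : ℕ → E) (r : ℕ → ℝ) (hr : ∀ k, 0 < r k)
    (h1 : ∀ k, q.d (x k) (x (k + 1)) + r (k + 1) < r k) (h2 : ∀ k, r (k + 1) ≤ r k / 2) :
    ∃ a ∈ ⋂ k, q.ball (x k) (r k), ∀ S : Set E, IsOpen S → a ∈ S →
      ∃ k, q.ball (x k) (r k) ⊆ S := by
  have hgeo : ∀ k, r k ≤ r 0 * (1 / 2) ^ k := by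
    intro k
    induction k with
    | zero => simp
    | succ k ih =>
      have := h2 k
      rw [pow_succ]
      linarith
  have hlim : Tendsto r atTop (𝓝 0) := by
    have h0 : Tendsto (fun k : ℕ => r 0 * (1 / 2 : ℝ) ^ k) atTop (𝓝 0) := by
      simpa using (tendsto_pow_atTop_nhds_zero_of_lt_one (r := (1 / 2 : ℝ))
        (by norm_num) (by norm_num)).const_mul (r 0)
    exact squeeze_zero (fun k => (hr k).le) hgeo h0
  have hd : ∀ n p, n ≤ p → q.d (x n) (x p) + r p ≤ r n := by
    intro n p hp
    induction p, hp using Nat.le_induction with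
    | base => simp [d_self]
    | succ p _ ih =>
      have := q.triangle (x n) (x p) (x (p + 1))
      have := h1 p
      linarith
  obtain ⟨a, ha⟩ := hq x fun ε hε => by
    obtain ⟨N, hN⟩ := eventually_atTop.1 (hlim.eventually_lt_const hε)
    refine ⟨N, fun n hn p hp => ?_⟩
    have := hd n p hp
    have := hr p
    have := hN n hn
    linarith
  have hle : ∀ k, q.d (x k) a ≤ r k := by
    intro k
    refine le_of_forall_pos_le_add fun ε hε => ?_
    obtain ⟨N, hN⟩ := eventually_atTop.1 (ha.eventually_lt_const hε)
    have e1 : q.d (x (max N k)) a < ε := lt_of_le_of_lt (le_max_left _ _) (hN _ (le_max_left _ _))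
    have := hd k (max N k) (le_max_right _ _)
    have := hr (max N k)
    have := q.triangle (x k) (x (max N k)) a
    linarith
  refine ⟨a, Set.mem_iInter.2 fun k => ?_, fun S hS haS => ?_⟩
  · have := q.triangle (x k) (x (k + 1)) a
    have := hle (k + 1)
    have := h1 k
    change q.d (x k) a < r k
    linarith
  · obtain ⟨ε, hε, hb⟩ := (isOpen_iff ht S).1 hS a haS
    obtain ⟨k, hk1, hk2⟩ := ((ha.eventually_lt_const (half_pos hε)).and
      (hlim.eventually_lt_const (half_pos hε))).exists
    refine ⟨k, fun y hy => hb ?_⟩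
    have e1 : q.d a (x k) < ε / 2 := lt_of_le_of_lt (le_max_right _ _) hk1
    have e2 : q.d (x k) y < r k := hy
    have := q.triangle a (x k) y
    change q.d a y < ε
    linarith

theorem IsComplete.isConvergentApproximationSpace [t : TopologicalSpace E]
    [SecondCountableTopology E] {q : QuasiMetric E} (ht : t = q.topology) (hq : q.IsComplete) :
    IsConvergentApproximationSpace E := by
  cases isEmpty_or_nonempty E
  · refine ⟨∅, fun _ _ => True, ?_, by simp, by simp, by simp, fun U hU => (hU 0).elim⟩
    exact TopologicalSpace.isTopologicalBasis_of_isOpen_of_nhds (by simp)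
      fun a => isEmptyElim a
  obtain ⟨s, hs⟩ := exists_seq_dense_hat ht
  let x : ℕ → E := fun n => s n.unpair.1
  let r : ℕ → ℝ := fun n => 1 / ((n.unpair.2 : ℝ) + 1)
  have hr : ∀ n, 0 < r n := fun n => Nat.one_div_pos_of_nat
  -- Every point lies in formal balls of arbitrarily small radius, with centres as near as desired.
  have hsmall : ∀ (y : E) (ε : ℝ), 0 < ε →
      ∃ c, q.d (x c) y < r c ∧ q.d y (x c) + r c < ε ∧ r c < ε := by
    intro y ε hε
    obtain ⟨j, hj⟩ := exists_nat_one_div_lt (half_pos hε)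
    obtain ⟨n, hn1, hn2⟩ := hs y (1 / ((j : ℝ) + 1)) Nat.one_div_pos_of_nat
    refine ⟨Nat.pair n j, ?_⟩
    simp only [x, r, Nat.unpair_pair]
    exact ⟨hn1, by linarith, by linarith⟩
  refine ⟨_, _, isConvergentApproximationRelation_of_chains (O := fun n => q.ball (x n) (r n))
    (prec := fun n m => q.d (x n) (x m) + r m < r n ∧ r m ≤ r n / 2) ?_ ?_ ?_ ?_⟩
  · refine TopologicalSpace.isTopologicalBasis_of_isOpen_of_nhds ?_ fun a u ha hu => ?_
    · rintro _ ⟨n, rfl⟩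
      exact isOpen_ball ht _ (hr n)
    · obtain ⟨ε, hε, hb⟩ := (isOpen_iff ht u).1 hu a ha
      obtain ⟨c, hc1, hc2, -⟩ := hsmall a ε hε
      refine ⟨_, ⟨c, rfl⟩, hc1, fun y hy => hb ?_⟩
      have hy' : q.d (x c) y < r c := hy
      have := q.triangle a (x c) y
      change q.d a y < ε
      linarith
  · rintro n m ⟨h, -⟩ y hy
    have hy' : q.d (x m) y < r m := hy
    have := q.triangle (x n) (x m) y
    change q.d (x n) y < r n
    linarith
  · intro n m y hn hm
    have hn' : q.d (x n) y < r n := hn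
    have hm' : q.d (x m) y < r m := hm
    obtain ⟨c, hc1, hc2, hc3⟩ := hsmall y
      (min (min (r n - q.d (x n) y) (r m - q.d (x m) y)) (min (r n / 2) (r m / 2)))
      (lt_min (lt_min (by linarith) (by linarith)) (lt_min (half_pos (hr n)) (half_pos (hr m))))
    simp only [lt_min_iff] at hc2 hc3
    have := q.triangle (x n) y (x c)
    have := q.triangle (x m) y (x c)
    exact ⟨c, ⟨by linarith, hc3.2.1.le⟩, ⟨by linarith, hc3.2.2.le⟩, hc1⟩
  · intro c hc
    exact hq.exists_limit_of_chain ht (fun k => x (c k)) (fun k => r (c k)) (fun k => hr _)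
      (fun k => (hc k).1) (fun k => (hc k).2)

end QuasiMetric

/-! ### Quasi-metrics from sequences of functions -/

section FirstIncrease

variable {E : Type*}

open Classical in
/-- The quasi-distance `1 / (n + 1)`, with `n` the first index at which `f n x < f n y`, and `0` if
there is none. -/
noncomputable def firstIncreaseDist (f : ℕ → E → ℕ∞) (x y : E) : ℝ :=
  if h : ∃ n, f n x < f n y then 1 / ((Nat.find h : ℝ) + 1) else 0

theorem firstIncreaseDist_nonneg (f : ℕ → E → ℕ∞) (x y : E) : 0 ≤ firstIncreaseDist f x y := by
  unfold firstIncreaseDist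
  split_ifs
  · positivity
  · exact le_rfl

theorem firstIncreaseDist_lt_iff (f : ℕ → E → ℕ∞) (x y : E) (N : ℕ) :
    firstIncreaseDist f x y < 1 / ((N : ℝ) + 1) ↔ ∀ n ≤ N, f n y ≤ f n x := by
  classical
  unfold firstIncreaseDist
  split_ifs with h
  · rw [one_div_lt_one_div (by positivity) (by positivity), add_lt_add_iff_right, Nat.cast_lt,
      Nat.lt_find_iff]
    simp only [not_lt]
  · push Not at h
    exact iff_of_true Nat.one_div_pos_of_nat fun n _ => h n

theorem firstIncreaseDist_eq_zero_iff (f : ℕ → E → ℕ∞) (x y : E) :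
    firstIncreaseDist f x y = 0 ↔ ∀ n, f n y ≤ f n x := by
  constructor
  · intro h n
    refine (firstIncreaseDist_lt_iff f x y n).1 ?_ n le_rfl
    rw [h]
    exact Nat.one_div_pos_of_nat
  · intro h
    exact dif_neg fun ⟨n, hn⟩ => (h n).not_gt hn

theorem firstIncreaseDist_triangle (f : ℕ → E → ℕ∞) (x y z : E) :
    firstIncreaseDist f x z ≤ firstIncreaseDist f x y + firstIncreaseDist f y z := by
  classical
  by_cases h : ∃ n, f n x < f n z
  · have e : firstIncreaseDist f x z = 1 / ((Nat.find h : ℝ) + 1) := dif_pos h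
    have hn := Nat.find_spec h
    have h1 := firstIncreaseDist_nonneg f x y
    have h2 := firstIncreaseDist_nonneg f y z
    by_contra! hlt
    rw [e] at hlt
    have h3 := (firstIncreaseDist_lt_iff f x y (Nat.find h)).1 (by linarith) _ le_rfl
    have h4 := (firstIncreaseDist_lt_iff f y z (Nat.find h)).1 (by linarith) _ le_rfl
    exact (h4.trans h3).not_gt hn
  · rw [firstIncreaseDist, dif_neg h]
    exact add_nonneg (firstIncreaseDist_nonneg f x y) (firstIncreaseDist_nonneg f y z)

/-- A sequence of functions to `ℕ∞` whose sublevel sets `{y | f n y ≤ f n x}` form a basis of open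
neighbourhoods of each point `x`, and such that any sequence of points along which all of them are
eventually non-increasing has a limit at which they take their eventual values, makes the space
quasi-Polish. -/
theorem isQuasiPolish_of_functions [t : TopologicalSpace E] [T0Space E]
    [SecondCountableTopology E] (f : ℕ → E → ℕ∞)
    (hopen : ∀ n x, IsOpen {y | f n y ≤ f n x})
    (hnhds : ∀ S : Set E, IsOpen S → ∀ x ∈ S, ∃ n, {y | f n y ≤ f n x} ⊆ S)
    (hlim : ∀ x : ℕ → E, (∀ n, ∃ N, ∀ i, N ≤ i → ∀ p, i ≤ p → f n (x p) ≤ f n (x i)) →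
      ∃ a, ∀ n, ∀ᶠ i in atTop, f n (x i) = f n a) :
    IsQuasiPolish E := by
  let q : QuasiMetric E :=
    { d := firstIncreaseDist f
      nonneg := firstIncreaseDist_nonneg f
      eq_iff := by
        intro x y
        rw [firstIncreaseDist_eq_zero_iff, firstIncreaseDist_eq_zero_iff]
        refine ⟨by rintro rfl; simp, fun ⟨h1, h2⟩ => ?_⟩
        refine (inseparable_iff_forall_isOpen.2 fun S hS => ⟨fun hx => ?_, fun hy => ?_⟩).eq
        · obtain ⟨n, hn⟩ := hnhds S hS x hx
          exact hn (h1 n)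
        · obtain ⟨n, hn⟩ := hnhds S hS y hy
          exact hn (h2 n)
      triangle := firstIncreaseDist_triangle f }
  refine ⟨inferInstance, q, ?_, le_antisymm ?_ ?_⟩
  · intro x hx
    obtain ⟨a, ha⟩ := hlim x fun n => by
      obtain ⟨N, hN⟩ := hx (1 / ((n : ℝ) + 1)) Nat.one_div_pos_of_nat
      exact ⟨N, fun i hi p hp => (firstIncreaseDist_lt_iff f _ _ n).1 (hN i hi p hp) n le_rfl⟩
    refine ⟨a, Metric.tendsto_atTop.2 fun ε hε => ?_⟩
    obtain ⟨M, hM⟩ := exists_nat_one_div_lt hε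
    have hev : ∀ᶠ i in atTop, ∀ n ∈ Set.Iic M, f n (x i) = f n a :=
      ((Set.finite_Iic M).eventually_all).2 fun n _ => ha n
    obtain ⟨N, hN⟩ := eventually_atTop.1 hev
    refine ⟨N, fun i hi => ?_⟩
    have h1 : firstIncreaseDist f (x i) a < 1 / ((M : ℝ) + 1) :=
      (firstIncreaseDist_lt_iff f _ _ M).2 fun n hn => (hN i hi n hn).ge
    have h2 : firstIncreaseDist f a (x i) < 1 / ((M : ℝ) + 1) :=
      (firstIncreaseDist_lt_iff f _ _ M).2 fun n hn => (hN i hi n hn).le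
    have h0 : 0 ≤ q.hat (x i) a := (q.nonneg _ _).trans (le_max_left _ _)
    rw [Real.dist_0_eq_abs, abs_of_nonneg h0]
    exact (max_lt h1 h2).trans hM
  · refine le_generateFrom ?_
    rintro _ ⟨x, r, -, rfl⟩
    refine isOpen_iff_mem_nhds.2 fun y hy => ?_
    have hy' : q.d x y < r := hy
    obtain ⟨M, hM⟩ := exists_nat_one_div_lt (sub_pos.2 hy')
    have hO : IsOpen (⋂ n ∈ Set.Iic M, {z | f n z ≤ f n y}) :=
      (Set.finite_Iic M).isOpen_biInter fun n _ => hopen n y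
    refine mem_of_superset (hO.mem_nhds (by simp)) fun z hz => ?_
    have hyz : q.d y z < 1 / ((M : ℝ) + 1) :=
      (firstIncreaseDist_lt_iff f y z M).2 fun n hn => Set.mem_iInter₂.1 hz n hn
    have := q.triangle x y z
    change q.d x z < r
    linarith
  · intro S hS
    refine (@QuasiMetric.isOpen_iff E q.topology q rfl S).2 fun x hx => ?_
    obtain ⟨n, hn⟩ := hnhds S hS x hx
    refine ⟨1 / ((n : ℝ) + 1), Nat.one_div_pos_of_nat, fun y hy => hn ?_⟩
    exact (firstIncreaseDist_lt_iff f x y n).1 hy n le_rfl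

end FirstIncrease

/-! ### From an approximation relation to a complete quasi-metric -/

section LeastIndex

variable {E : Type*}

/-- A convergent approximation relation passes to any other basis, by interpolation of a related pair
of the old basis. -/
theorem IsConvergentApproximationRelation.change_basis [TopologicalSpace E] {B C : Set (Set E)}
    {R : Set E → Set E → Prop} (h : IsConvergentApproximationRelation B R)
    (hC : TopologicalSpace.IsTopologicalBasis C) :
    IsConvergentApproximationRelation C
      fun U V => ∃ T ∈ B, ∃ S ∈ B, T ⊆ U ∧ R T S ∧ V ⊆ S where
  isBasis := hC
  subset := by
    rintro U - V - ⟨T, hT, S, hS, hTU, hR, hVS⟩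
    exact hVS.trans ((h.subset T hT S hS hR).trans hTU)
  mono := by
    rintro U - V - U' - hU ⟨T, hT, S, hS, hTU, hR, hVS⟩
    exact ⟨T, hT, S, hS, hTU.trans hU, hR, hVS⟩
  exists_mem := by
    intro U hU x hx
    obtain ⟨T, hT, hxT, hTU⟩ := h.isBasis.exists_subset_of_mem_open hx (hC.isOpen hU)
    obtain ⟨S, hS, hxS, hR⟩ := h.exists_mem T hT x hxT
    obtain ⟨V, hV, hxV, hVS⟩ := hC.exists_subset_of_mem_open hxS (h.isBasis.isOpen hS)
    exact ⟨V, hV, hxV, T, hT, S, hS, hTU, hR, hVS⟩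
  converges := by
    intro U _ hU
    choose T hT S hS hTU hR hVS using hU
    obtain ⟨x, hx, hn⟩ := h.converges S hS fun i =>
      h.mono _ (hT (i + 1)) _ (hS (i + 1)) _ (hS i) ((hTU (i + 1)).trans (hVS i)) (hR (i + 1))
    refine ⟨x, Set.mem_iInter.2 fun i => ?_, fun O hO hxO => ?_⟩
    · exact hTU i (h.subset _ (hT i) _ (hS i) (hR i) (Set.mem_iInter.1 hx i))
    · obtain ⟨i, hi⟩ := hn O hO hxO
      exact ⟨i + 1, (hVS i).trans hi⟩

/-- The least index `v` satisfying `A` with `x ∈ W v`, and `⊤` if there is none. -/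
noncomputable def leastIndex (W : ℕ → Set E) (A : ℕ → Prop) (x : E) : ℕ∞ :=
  sInf ((fun v : ℕ => (v : ℕ∞)) '' {v | A v ∧ x ∈ W v})

variable {W : ℕ → Set E} {A : ℕ → Prop}

theorem leastIndex_le {x : E} {v : ℕ} (hA : A v) (hx : x ∈ W v) : leastIndex W A x ≤ v :=
  sInf_le ⟨v, ⟨hA, hx⟩, rfl⟩

theorem leastIndex_spec {x : E} {v : ℕ} (h : leastIndex W A x = v) : A v ∧ x ∈ W v :=
  ENat.mem_of_sInf_coe_eq (S := {v | A v ∧ x ∈ W v}) h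

theorem exists_of_leastIndex_le {x : E} {v : ℕ} (h : leastIndex W A x ≤ v) :
    ∃ w ≤ v, A w ∧ x ∈ W w := by
  obtain ⟨w, hw⟩ := ENat.ne_top_iff_exists.1 (ne_top_of_le_ne_top (ENat.natCast_ne_top v) h)
  refine ⟨w, ?_, leastIndex_spec hw.symm⟩
  rw [← hw] at h
  exact_mod_cast h

theorem isOpen_leastIndex_le [TopologicalSpace E] (hW : ∀ v, IsOpen (W v)) (m : ℕ∞) :
    IsOpen {y | leastIndex W A y ≤ m} := by
  refine isOpen_iff_mem_nhds.2 fun y hy => ?_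
  rcases eq_or_ne (leastIndex W A y) ⊤ with h | h
  · have hm : m = ⊤ := top_le_iff.1 (h ▸ hy)
    simp [hm]
  · obtain ⟨v, hv⟩ := ENat.ne_top_iff_exists.1 h
    obtain ⟨hA, hx⟩ := leastIndex_spec hv.symm
    refine mem_of_superset ((hW v).mem_nhds hx) fun z hz => ?_
    exact (leastIndex_le hA hz).trans (hv.le.trans hy)

theorem IsConvergentApproximationRelation.isQuasiPolish [TopologicalSpace E] [T0Space E]
    [SecondCountableTopology E] {R : Set E → Set E → Prop}
    (h : IsConvergentApproximationRelation (Set.range W) R) : IsQuasiPolish E := by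
  have hWo : ∀ v, IsOpen (W v) := fun v => h.isBasis.isOpen ⟨v, rfl⟩
  -- The vacuous constraint at `0` provides the first member of the chain constructed below.
  let A : ℕ → ℕ → Prop
    | 0 => fun _ => True
    | n + 1 => fun v => W v ⊆ W n.unpair.2 ∧ R (W n.unpair.1) (W v)
  have hA : ∀ u o v, A (Nat.pair u o + 1) v ↔ W v ⊆ W o ∧ R (W u) (W v) := by
    intro u o v
    simp [A]
  have hex : ∀ u o x, x ∈ W u → x ∈ W o → ∃ v, A (Nat.pair u o + 1) v ∧ x ∈ W v := by
    intro u o x hu ho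
    obtain ⟨_, ⟨T, rfl⟩, hxT, hT⟩ := h.isBasis.exists_subset_of_mem_open
      (⟨hu, ho⟩ : x ∈ W u ∩ W o) ((hWo u).inter (hWo o))
    obtain ⟨_, ⟨v, rfl⟩, hxv, hv⟩ := h.exists_mem _ ⟨T, rfl⟩ x hxT
    refine ⟨v, (hA u o v).2 ⟨?_, ?_⟩, hxv⟩
    · exact (h.subset _ ⟨T, rfl⟩ _ ⟨v, rfl⟩ hv).trans (hT.trans Set.inter_subset_right)
    · exact h.mono _ ⟨T, rfl⟩ _ ⟨v, rfl⟩ _ ⟨u, rfl⟩ (hT.trans Set.inter_subset_left) hv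
  refine isQuasiPolish_of_functions (fun n => leastIndex W (A n))
    (fun n x => isOpen_leastIndex_le hWo _) ?_ ?_
  · intro S hS x hx
    obtain ⟨_, ⟨o, rfl⟩, hxo, ho⟩ := h.isBasis.exists_subset_of_mem_open hx hS
    obtain ⟨v, hv, hxv⟩ := hex o o x hxo hxo
    refine ⟨Nat.pair o o + 1, fun y hy => ho ?_⟩
    obtain ⟨w, -, hw, hyw⟩ := exists_of_leastIndex_le (hy.trans (leastIndex_le hv hxv))
    exact ((hA o o w).1 hw).1 hyw
  · intro x hx
    have hconst : ∀ n, ∃ L, ∀ᶠ i in atTop, leastIndex W (A n) (x i) = L := by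
      intro n
      obtain ⟨N, hN⟩ := hx n
      obtain ⟨M, -, hM⟩ := exists_forall_ge_eq_of_antitone hN
      exact ⟨_, eventually_atTop.2 ⟨M, hM⟩⟩
    choose L hL using hconst
    have hfin : ∀ n (v : ℕ), L n = v → A n v ∧ ∀ᶠ i in atTop, x i ∈ W v := by
      intro n v hv
      have hs := (hL n).mono fun i hi => leastIndex_spec (hi.trans hv)
      exact ⟨hs.exists.choose_spec.1, hs.mono fun i hi => hi.2⟩
    have hnext : ∀ n, (∀ᶠ i in atTop, ∃ v, A n v ∧ x i ∈ W v) →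
        ∃ v, A n v ∧ ∀ᶠ i in atTop, x i ∈ W v := by
      intro n hn
      obtain ⟨i, hi, v, hAv, hxv⟩ := ((hL n).and hn).exists
      have hne : L n ≠ ⊤ := by
        rw [← hi]
        exact ne_top_of_le_ne_top (ENat.natCast_ne_top v) (leastIndex_le hAv hxv)
      obtain ⟨w, hw⟩ := ENat.ne_top_iff_exists.1 hne
      exact ⟨w, hfin n w hw.symm⟩
    obtain ⟨u₀, -, hu₀⟩ := hnext 0 (Eventually.of_forall fun i => by
      obtain ⟨_, ⟨v, rfl⟩, hv, -⟩ :=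
        h.isBasis.exists_subset_of_mem_open (Set.mem_univ (x i)) isOpen_univ
      exact ⟨v, trivial, hv⟩)
    have hstep : ∀ (u : {u : ℕ // ∀ᶠ i in atTop, x i ∈ W u}) (j : ℕ),
        ∃ v : {v : ℕ // ∀ᶠ i in atTop, x i ∈ W v}, R (W u) (W v) ∧
          ((∀ᶠ i in atTop, x i ∈ W j) → W v ⊆ W j) := by
      rintro ⟨u, hu⟩ j
      by_cases hj : ∀ᶠ i in atTop, x i ∈ W j
      · obtain ⟨v, hv, hxv⟩ := hnext (Nat.pair u j + 1)
          ((hu.and hj).mono fun i hi => hex u j _ hi.1 hi.2)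
        exact ⟨⟨v, hxv⟩, ((hA u j v).1 hv).2, fun _ => ((hA u j v).1 hv).1⟩
      · obtain ⟨v, hv, hxv⟩ := hnext (Nat.pair u u + 1) (hu.mono fun i hi => hex u u _ hi hi)
        exact ⟨⟨v, hxv⟩, ((hA u u v).1 hv).2, fun h => (hj h).elim⟩
    choose next hnextR hnextsub using hstep
    let U : ℕ → {u : ℕ // ∀ᶠ i in atTop, x i ∈ W u} :=
      fun j => Nat.rec ⟨u₀, hu₀⟩ (fun j u => next u j) j
    have hUR : ∀ j, R (W (U j).1) (W (U (j + 1)).1) := fun j => hnextR (U j) j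
    obtain ⟨a, ha, hnhds⟩ := h.converges (fun j => W (U j).1) (fun j => ⟨_, rfl⟩)
      hUR
    have hmem : ∀ v, a ∈ W v ↔ ∀ᶠ i in atTop, x i ∈ W v := by
      intro v
      constructor
      · intro hv
        obtain ⟨j, hj⟩ := hnhds _ (hWo v) hv
        exact (U j).2.mono fun i hi => hj hi
      · exact fun hv => hnextsub (U v) v hv (Set.mem_iInter.1 ha (v + 1))
    refine ⟨a, fun n => ?_⟩
    suffices e : leastIndex W (A n) a = L n by
      rw [e]
      exact hL n
    apply le_antisymm
    · rcases eq_or_ne (L n) ⊤ with hT | hT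
      · rw [hT]
        exact le_top
      · obtain ⟨v, hv⟩ := ENat.ne_top_iff_exists.1 hT
        obtain ⟨h1, h2⟩ := hfin n v hv.symm
        rw [← hv]
        exact leastIndex_le h1 ((hmem v).2 h2)
    · rcases eq_or_ne (leastIndex W (A n) a) ⊤ with hT | hT
      · rw [hT]
        exact le_top
      · obtain ⟨v, hv⟩ := ENat.ne_top_iff_exists.1 hT
        obtain ⟨h1, h2⟩ := leastIndex_spec hv.symm
        obtain ⟨i, hi, hxi⟩ := ((hL n).and ((hmem v).1 h2)).exists
        rw [← hv, ← hi]
        exact leastIndex_le h1 hxi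

end LeastIndex

theorem theorem3p10 {E : Type*} [TopologicalSpace E] :
    IsQuasiPolish E ↔
      T0Space E ∧ SecondCountableTopology E ∧ IsConvergentApproximationSpace E := by
  constructor
  · rintro ⟨hsc, q, hq, ht⟩
    exact ⟨QuasiMetric.t0Space ht, hsc, hq.isConvergentApproximationSpace ht⟩
  · rintro ⟨hT0, hsc, B, R, h⟩
    obtain ⟨W, hW⟩ := exists_seq_isTopologicalBasis E
    exact (h.change_basis hW).isQuasiPolish
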